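/- **Theorem.** For positive integers $n$ (agents) and $m$ (items), let each of the $n$ agents draw, independently of the others, a uniformly random strict ranking of the $m$ items. An *assignment* gives each agent exactly one item, with no item given to two agents (the remaining items are left unassigned); it is *envy-free* if every agent ranks her own item at least as high as the item of every other agent. Let $\varepsilon>0$ be a constant and let $m=m(n)$ be any function of $n$. 1. If $\frac{m(n)}{n}\ge e+\varepsilon$ for all sufficiently large $n$, then the probability that an envy-free assignment exists tends to $1$ as $n\to\infty$. 2. If $\frac{m(n)}{n}\le e-\varepsilon$ for all sufficiently large $n$, then the probability that no envy-free assignment exists tends to $1$ as $n\to\infty$. -/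

import Mathlib

open MeasureTheory Filter Topology

namespace HouseAllocation

/-- A strict ranking of the `m` items `Fin m`: the permutation sends an item to its position
in the ranking, position `0` being the most preferred. -/
def Ranking (m : ℕ) : Type := Equiv.Perm (Fin m)

namespace Ranking

instance (m : ℕ) : Fintype (Ranking m) := inferInstanceAs (Fintype (Equiv.Perm (Fin m)))

instance (m : ℕ) : Nonempty (Ranking m) := inferInstanceAs (Nonempty (Equiv.Perm (Fin m)))

instance (m : ℕ) : MeasurableSpace (Ranking m) := ⊤

instance (m : ℕ) : DiscreteMeasurableSpace (Ranking m) := ⟨fun _ => trivial⟩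

/-- The position of item `j` in the ranking `r`. -/
def position {m : ℕ} (r : Ranking m) (j : Fin m) : Fin m := Equiv.toFun r j

/-- An agent with ranking `r` likes item `j` at least as much as item `k`. -/
def WeaklyPrefers {m : ℕ} (r : Ranking m) (j k : Fin m) : Prop := r.position j ≤ r.position k

end Ranking

/-- An assignment gives every agent exactly one item, and no item to two agents; items may
remain unassigned. -/
def IsAssignment {n m : ℕ} (ψ : Fin n → Fin m) : Prop := Function.Injective ψ

/-- Every agent likes her own item at least as much as the item of any other agent. -/
def IsEnvyFree {n m : ℕ} (r : Fin n → Ranking m) (ψ : Fin n → Fin m) : Prop :=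
  ∀ i i' : Fin n, (r i).WeaklyPrefers (ψ i) (ψ i')

/-- The event that the ranking profile admits an envy-free assignment. -/
def envyFreeAssignmentExists (n m : ℕ) : Set (Fin n → Ranking m) :=
  {r | ∃ ψ : Fin n → Fin m, IsAssignment ψ ∧ IsEnvyFree r ψ}

/-- The law of a random ranking profile: the `n` agents independently draw uniformly random
strict rankings of the `m` items. -/
noncomputable def profileLaw (n m : ℕ) : Measure (Fin n → Ranking m) :=
  Measure.pi fun _ : Fin n => (PMF.uniformOfFintype (Ranking m)).toMeasure

end HouseAllocation

namespace HouseAllocation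

open Finset Function

/-! Rankings are revealed lazily. Keep a set `S` of items still in play and a set `D` of agents
whose favourites in `S` are known and distinct. Reveal the favourite in `S` of one more agent. If it
is free, the agent joins `D`. If it is the item of some `l ∈ D`, no envy-free assignment within `S`
can use it, since both agents would have to receive it; so it is discarded and both agents become
unsettled. The other settled agents keep their favourites, and what is known says nothing about the
order of the remaining items. Each new favourite is therefore uniform on `S`, and the pair (free
items `f`, taken items `k`) is a Markov chain started at `(m, 0)`. It succeeds when `k` reaches `n`
and fails when `f + k < n`. This reduction is `card_pow_mul_settledCount`, stated by exact counting.

The quantity `k / (f + 1) + H_f` is a martingale of the chain, with initial value `H_m ≈ log m`. As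
long as `f` stays of order `n`, its total quadratic variation is `O(1/n)`, so it stays close to
`H_m`. On the success line `k = n` it is about `n / f + log f`, which is at least `1 + log n`, with
equality at `f = n`. If `m > e n`, a failing chain must first reach `f = n` with `k < n`, where the
martingale is below `1 + H_n < H_m`. If `m < e n`, success would require it to rise above `H_m`.
Either event needs a deviation by a constant, and a Chebyshev bound through the supermartingale
`quadPotential` gives it probability `O(1/n)` (`one_sub_successProb_le`, `successProb_le`). -/

/-- Item `x` is the favourite of an agent with ranking `r` among the items in `S`. -/
def IsTop {m : ℕ} (r : Ranking m) (S : Finset (Fin m)) (x : Fin m) : Prop :=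
  x ∈ S ∧ ∀ y ∈ S, r.WeaklyPrefers x y

/-- The rankings `r` and `r'` order the items of `S` in the same way. -/
def SameOrder {m : ℕ} (S : Finset (Fin m)) (r r' : Ranking m) : Prop :=
  ∀ y ∈ S, ∀ z ∈ S, r.WeaklyPrefers y z ↔ r'.WeaklyPrefers y z

lemma IsTop.unique {m : ℕ} {r : Ranking m} {S : Finset (Fin m)} {x y : Fin m}
    (hx : IsTop r S x) (hy : IsTop r S y) : x = y :=
  (Equiv.injective r) (le_antisymm (hx.2 y hy.1) (hy.2 x hx.1))

lemma exists_isTop {m : ℕ} (r : Ranking m) {S : Finset (Fin m)} (hS : S.Nonempty) :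
    ∃ x, IsTop r S x := by
  obtain ⟨x, hx, h⟩ := S.exists_min_image (fun y => r.position y) hS
  exact ⟨x, hx, h⟩

lemma SameOrder.isTop_iff {m : ℕ} {S : Finset (Fin m)} {r r' : Ranking m}
    (h : SameOrder S r r') (x : Fin m) : IsTop r S x ↔ IsTop r' S x := by
  refine and_congr_right fun hx => forall₂_congr fun y hy => h x hx y hy

/-! ### Favourites under one uniformly random ranking. -/

section Permutations

variable {m : ℕ}

lemma exists_perm_sameOrder (S : Finset (Fin m)) (r r' : Equiv.Perm (Fin m)) :
    ∃ g : Equiv.Perm {y // y ∈ S},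
      SameOrder S (r * Equiv.Perm.ofSubtype g : Equiv.Perm (Fin m)) r' := by
  have hc : ∀ u : Equiv.Perm (Fin m), (S.image u).card = S.card := fun u =>
    card_image_of_injective S u.injective
  have key : ∀ u : Equiv.Perm (Fin m), ∃ v : Fin S.card ≃ {y // y ∈ S},
      ∀ a b, u (v a) ≤ u (v b) ↔ a ≤ b := by
    intro u
    -- `v` lists the items of `S` in the order in which `u` ranks them.
    refine ⟨((S.image u).orderIsoOfFin (hc u)).toEquiv.trans
      (u.subtypeEquiv (p := fun y => y ∈ S) (q := fun y => y ∈ S.image u)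
        (by intro a; simp)).symm, ?_⟩
    intro a b
    simp [Equiv.subtypeEquiv]
  obtain ⟨v, hv⟩ := key r
  obtain ⟨v', hv'⟩ := key r'
  -- This `g` sends the `a`-th item of `S` under `r'` to the `a`-th item under `r`.
  refine ⟨v'.symm.trans v, fun y hy z hz => ?_⟩
  have h1 : ∀ y, ∀ hy : y ∈ S, (r * Equiv.Perm.ofSubtype (v'.symm.trans v)) y
      = r (v (v'.symm ⟨y, hy⟩)) := by
    intro y hy
    rw [Equiv.Perm.mul_apply, Equiv.Perm.ofSubtype_apply_of_mem _ hy]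
    rfl
  change (r * Equiv.Perm.ofSubtype (v'.symm.trans v)) y ≤
    (r * Equiv.Perm.ofSubtype (v'.symm.trans v)) z ↔ r' y ≤ r' z
  rw [h1 y hy, h1 z hz, hv, ← hv']
  simp

lemma SameOrder.mul_ofSubtype {S : Finset (Fin m)} {r r' : Equiv.Perm (Fin m)}
    (h : SameOrder S r r') (g : Equiv.Perm {y // y ∈ S}) :
    SameOrder S (r * Equiv.Perm.ofSubtype g : Equiv.Perm (Fin m))
      (r' * Equiv.Perm.ofSubtype g : Equiv.Perm (Fin m)) := by
  intro y hy z hz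
  have h1 : ∀ y ∈ S, Equiv.Perm.ofSubtype g y ∈ S := by
    intro y hy
    rw [Equiv.Perm.ofSubtype_apply_of_mem _ hy]
    exact (g _).2
  exact h _ (h1 y hy) _ (h1 z hz)

lemma isTop_mul_iff {S : Finset (Fin m)} (r g : Equiv.Perm (Fin m))
    (hg : ∀ y, g y ∈ S ↔ y ∈ S) (x : Fin m) :
    IsTop (r * g : Equiv.Perm (Fin m)) S x ↔ IsTop r S (g x) := by
  constructor
  · rintro ⟨hx, h⟩
    refine ⟨(hg x).2 hx, fun y hy => ?_⟩
    have := h (g.symm y) ((hg _).1 (by simpa using hy))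
    change r (g x) ≤ r (g (g.symm y)) at this
    rwa [Equiv.apply_symm_apply] at this
  · rintro ⟨hx, h⟩
    exact ⟨(hg x).1 hx, fun y hy => h (g y) ((hg y).2 hy)⟩

open Classical in
lemma card_mul_sum_isTop {S : Finset (Fin m)} {x : Fin m} (hx : x ∈ S) :
    (S.card : ℝ) * ∑ r : Equiv.Perm (Fin m), (if IsTop r S x then (1 : ℝ) else 0)
      = Fintype.card (Equiv.Perm (Fin m)) := by
  have h1 : ∀ y ∈ S, ∑ r : Equiv.Perm (Fin m), (if IsTop r S y then (1 : ℝ) else 0)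
      = ∑ r : Equiv.Perm (Fin m), (if IsTop r S x then (1 : ℝ) else 0) := by
    intro y hy
    refine Fintype.sum_equiv (Equiv.mulRight (Equiv.swap x y)) _ _ fun r => ?_
    have : IsTop (r * Equiv.swap x y : Equiv.Perm (Fin m)) S x ↔ IsTop r S y := by
      rw [isTop_mul_iff, Equiv.swap_apply_left]
      intro z
      by_cases hzx : z = x
      · subst hzx; simp [hx, hy]
      · by_cases hzy : z = y
        · subst hzy; simp [hx, hy]
        · rw [Equiv.swap_apply_of_ne_of_ne hzx hzy]
    simp only [Equiv.coe_mulRight, this]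
  have h2 : ∀ r : Equiv.Perm (Fin m), ∑ y ∈ S, (if IsTop r S y then (1 : ℝ) else 0) = 1 := by
    intro r
    obtain ⟨t, ht⟩ := exists_isTop (m := m) r ⟨x, hx⟩
    rw [sum_eq_single t]
    · simp [ht]
    · intro b _ hb
      exact if_neg fun h => hb (h.unique ht)
    · intro h; exact absurd ht.1 h
  rw [← nsmul_eq_mul, ← sum_const, ← sum_congr rfl h1, sum_comm, sum_congr rfl fun r _ => h2 r]
  simp

open Classical in
/-- Under a uniformly random ranking, whether `x` is the favourite in `S` is independent of the
order of the other items of `S`. -/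
lemma card_mul_sum_ite_isTop {S : Finset (Fin m)} {x : Fin m} (hx : x ∈ S)
    (h : Ranking m → ℝ) (hh : ∀ r r', SameOrder (S.erase x) r r' → h r = h r') :
    (S.card : ℝ) * ∑ r : Ranking m, (if IsTop r S x then h r else 0) = ∑ r, h r := by
  let S' := S.erase x
  let G := Equiv.Perm {y // y ∈ S'}
  let ι : G → Equiv.Perm (Fin m) := fun g => Equiv.Perm.ofSubtype g
  let h' : Equiv.Perm (Fin m) → ℝ := h
  -- Permuting the items of `S'` groups the rankings into cosets. Each coset realises every order of
  -- `S'`, so `h'` has the same sum over all of them.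
  have hconst : ∀ r : Equiv.Perm (Fin m), ∑ g : G, h' (r * ι g) = ∑ g : G, h' (ι g) := by
    intro r
    obtain ⟨g₀, hg₀⟩ := exists_perm_sameOrder S' r 1
    refine (Fintype.sum_equiv (Equiv.mulLeft g₀) _ _ fun g => ?_).symm
    change h' (ι g) = h' (r * ι (g₀ * g))
    have := hh _ _ (hg₀.mul_ofSubtype g)
    rw [one_mul] at this
    simp only [ι, map_mul, ← mul_assoc]
    exact this.symm
  -- A weight constant on cosets is thus uncorrelated with `h'`. This is applied to the indicator of
  -- `x` being the favourite, and to the weight `1`.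
  have havg : ∀ w : Equiv.Perm (Fin m) → ℝ, (∀ r g, w (r * ι g) = w r) →
      (Fintype.card G : ℝ) * ∑ r, w r * h' r = (∑ r, w r) * ∑ g : G, h' (ι g) := by
    intro w hw
    have h1 : ∀ g : G, ∑ r, w r * h' (r * ι g) = ∑ r, w r * h' r := by
      intro g
      refine Fintype.sum_equiv (Equiv.mulRight (ι g)) _ _ fun r => ?_
      simp [hw]
    calc (Fintype.card G : ℝ) * ∑ r, w r * h' r = ∑ g : G, ∑ r, w r * h' (r * ι g) := by
          rw [sum_congr rfl fun g _ => h1 g]; simp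
      _ = ∑ r, w r * ∑ g : G, h' (r * ι g) := by
          rw [sum_comm]; simp only [mul_sum]
      _ = _ := by simp only [hconst, sum_mul]
  have hw := havg (fun r => if IsTop r S x then 1 else 0) (by
    intro r g
    have hfix : ι g x = x := Equiv.Perm.ofSubtype_apply_of_not_mem g (by simp [S'])
    have hmem : ∀ y, ι g y ∈ S ↔ y ∈ S := by
      intro y
      by_cases hy : y ∈ S'
      · have h1 : ι g y ∈ S' := by
          simp only [ι]
          rw [Equiv.Perm.ofSubtype_apply_of_mem _ hy]
          exact (g _).2
        exact iff_of_true (mem_of_mem_erase h1) (mem_of_mem_erase hy)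
      · rw [show ι g y = y from Equiv.Perm.ofSubtype_apply_of_not_mem g hy]
    simp only [isTop_mul_iff r (ι g) hmem x, hfix])
  have h1 := havg (fun _ => 1) (fun _ _ => rfl)
  have hs := card_mul_sum_isTop hx
  have hG : (Fintype.card G : ℝ) ≠ 0 := by exact_mod_cast Fintype.card_ne_zero
  simp only [one_mul, sum_const, card_univ, nsmul_eq_mul, mul_one, ite_mul, zero_mul] at hw h1
  refine mul_left_cancel₀ hG ?_
  change _ * (_ * ∑ r : Equiv.Perm (Fin m), (if IsTop r S x then h' r else 0))
    = _ * ∑ r : Equiv.Perm (Fin m), h' r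
  rw [h1, ← hs, mul_left_comm, hw, mul_assoc]

end Permutations

/-! ### Counting profiles, one revealed favourite at a time. -/

section Profiles

variable {n m : ℕ}

open Classical in
/-- The number of ranking profiles satisfying `P`. -/
noncomputable def count (P : (Fin n → Ranking m) → Prop) : ℝ :=
  ∑ r : Fin n → Ranking m, if P r then 1 else 0

/-- The property `P` depends on the ranking of agent `i` only through its order on `S`. -/
def DependsOnOrder (S : Finset (Fin m)) (i : Fin n) (P : (Fin n → Ranking m) → Prop) : Prop :=
  ∀ r r', (∀ j, j ≠ i → r j = r' j) → SameOrder S (r i) (r' i) → (P r ↔ P r')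

lemma count_congr {P P' : (Fin n → Ranking m) → Prop} (h : ∀ r, P r ↔ P' r) :
    count P = count P' := by
  congr 1; funext r; exact propext (h r)

lemma count_and_add_count_and_not (P A : (Fin n → Ranking m) → Prop) :
    count (fun r => P r ∧ A r) + count (fun r => P r ∧ ¬ A r) = count P := by
  classical
  unfold count
  rw [← sum_add_distrib]
  refine sum_congr rfl fun r _ => ?_
  by_cases h : P r <;> by_cases h' : A r <;> simp [h, h']

/-- With the other agents' rankings fixed, this is the one-ranking independence for agent `i`:
revealing her favourite costs exactly a factor `1 / |S|`. -/
lemma card_mul_count_isTop {S : Finset (Fin m)} {x : Fin m} (hx : x ∈ S) (i : Fin n)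
    {P : (Fin n → Ranking m) → Prop} (hP : DependsOnOrder (S.erase x) i P) :
    (S.card : ℝ) * count (fun r => P r ∧ IsTop (r i) S x) = count P := by
  classical
  unfold count
  let e := Equiv.funSplitAt i (Ranking m)
  rw [← e.symm.sum_comp, ← e.symm.sum_comp, Fintype.sum_prod_type_right,
    Fintype.sum_prod_type_right, mul_sum]
  refine sum_congr rfl fun b _ => ?_
  have hi : ∀ a, e.symm (a, b) i = a := fun a => by simp [e, Equiv.funSplitAt]
  rw [← card_mul_sum_ite_isTop hx (fun a => if P (e.symm (a, b)) then 1 else 0)]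
  · congr 1
    refine sum_congr rfl fun a _ => ?_
    by_cases h : IsTop a S x <;> simp [hi, h]
  · intro a a' haa
    have := hP (e.symm (a, b)) (e.symm (a', b)) (by
      intro j hj; simp [e, Equiv.funSplitAt, Equiv.piSplitAt, hj]) (by rw [hi, hi]; exact haa)
    simp only [this]

lemma card_mul_count_not_isTop {S : Finset (Fin m)} {x : Fin m} (hx : x ∈ S) (i : Fin n)
    {P : (Fin n → Ranking m) → Prop} (hP : DependsOnOrder (S.erase x) i P) :
    (S.card : ℝ) * count (fun r => P r ∧ ¬ IsTop (r i) S x) = (S.card - 1) * count P := by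
  have h1 := card_mul_count_isTop hx i hP
  have h2 := count_and_add_count_and_not P (fun r => IsTop (r i) S x)
  linear_combination (S.card : ℝ) * h2 - h1

lemma DependsOnOrder.and {S : Finset (Fin m)} {i : Fin n} {P A : (Fin n → Ranking m) → Prop}
    (hP : DependsOnOrder S i P) (hA : DependsOnOrder S i A) :
    DependsOnOrder S i (fun r => P r ∧ A r) :=
  fun r r' h h' => and_congr (hP r r' h h') (hA r r' h h')

lemma DependsOnOrder.of_notMem {S : Finset (Fin m)} {i : Fin n} {B : Fin n → Ranking m → Prop}
    {D : Finset (Fin n)} (hi : i ∉ D) :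
    DependsOnOrder S i (fun r => ∀ j ∈ D, B j (r j)) := by
  intro r r' h _
  refine forall₂_congr fun j hj => ?_
  rw [h j (by rintro rfl; exact hi hj)]

lemma dependsOnOrder_isTop (S : Finset (Fin m)) (i : Fin n) (D : Finset (Fin n))
    (φ : Fin n → Fin m) :
    DependsOnOrder S i (fun r => ∀ j ∈ D, IsTop (r j) S (φ j)) := by
  intro r r' h h'
  refine forall₂_congr fun j _ => ?_
  by_cases hj : j = i
  · subst hj; exact h'.isTop_iff _
  · rw [h j hj]

lemma card_pow_mul_count_not_isTop {S : Finset (Fin m)} {x : Fin m} (hx : x ∈ S)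
    {P : (Fin n → Ranking m) → Prop} (hP : ∀ i, DependsOnOrder (S.erase x) i P)
    (D : Finset (Fin n)) :
    (S.card : ℝ) ^ D.card * count (fun r => P r ∧ ∀ j ∈ D, ¬ IsTop (r j) S x)
      = (S.card - 1) ^ D.card * count P := by
  classical
  induction D using Finset.induction_on with
  | empty => simp
  | insert i D hi ih =>
    have h1 := card_mul_count_not_isTop hx i
      ((hP i).and (DependsOnOrder.of_notMem (B := fun _ a => ¬ IsTop a S x) hi))
    rw [card_insert_of_notMem hi, pow_succ, pow_succ, mul_assoc,
      count_congr (P' := fun r => (P r ∧ ∀ j ∈ D, ¬ IsTop (r j) S x) ∧ ¬ IsTop (r i) S x)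
        (by intro r; simp only [forall_mem_insert]; tauto), h1]
    linear_combination (S.card - 1 : ℝ) * ih

lemma card_pow_mul_count_isTop {S : Finset (Fin m)} (D : Finset (Fin n)) (φ : Fin n → Fin m)
    (hφ : ∀ i ∈ D, φ i ∈ S) :
    (S.card : ℝ) ^ D.card * count (fun r : Fin n → Ranking m => ∀ j ∈ D, IsTop (r j) S (φ j))
      = count (fun _ : Fin n → Ranking m => True) := by
  classical
  induction D using Finset.induction_on with
  | empty => simp
  | insert i D hi ih =>
    have h1 := card_mul_count_isTop (hφ i (mem_insert_self i D)) i
      (DependsOnOrder.of_notMem (B := fun j a => IsTop a S (φ j)) hi)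
    rw [card_insert_of_notMem hi, pow_succ, mul_assoc,
      count_congr (P' := fun r => (∀ j ∈ D, IsTop (r j) S (φ j)) ∧ IsTop (r i) S (φ i))
        (by intro r; simp only [forall_mem_insert]; tauto), h1]
    exact ih fun j hj => hφ j (mem_insert_of_mem hj)

/-- There is an envy-free assignment that uses only items of `S`. -/
def EnvyFreeWithin (S : Finset (Fin m)) (r : Fin n → Ranking m) : Prop :=
  ∃ ψ : Fin n → Fin m, IsAssignment ψ ∧ (∀ i, ψ i ∈ S) ∧ IsEnvyFree r ψ

lemma dependsOnOrder_envyFreeWithin (S : Finset (Fin m)) (i : Fin n) :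
    DependsOnOrder S i (EnvyFreeWithin (n := n) S) := by
  intro r r' h h'
  refine exists_congr fun ψ => and_congr_right fun _ => and_congr_right fun hψ =>
    forall₂_congr fun j j' => ?_
  by_cases hj : j = i
  · subst hj; exact h' _ (hψ _) _ (hψ _)
  · rw [h j hj]

lemma EnvyFreeWithin.le_card {S : Finset (Fin m)} {r : Fin n → Ranking m}
    (h : EnvyFreeWithin S r) : n ≤ S.card := by
  obtain ⟨ψ, hψ, hS, -⟩ := h
  simpa using Finset.card_le_card_of_injOn (s := univ) ψ (fun i _ => hS i) hψ.injOn

/-- If anyone received `x`, then `i` and `l` would both have to own `x` in order not to envy. -/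
lemma envyFreeWithin_erase_iff {S : Finset (Fin m)} {r : Fin n → Ranking m} {x : Fin m}
    {i l : Fin n} (hil : i ≠ l) (hi : IsTop (r i) S x) (hl : IsTop (r l) S x) :
    EnvyFreeWithin S r ↔ EnvyFreeWithin (S.erase x) r := by
  constructor
  · rintro ⟨ψ, hψ, hS, hE⟩
    refine ⟨ψ, hψ, fun a => mem_erase.2 ⟨fun ha => hil (hψ ?_), hS a⟩, hE⟩
    have key : ∀ b, IsTop (r b) S x → ψ b = x := fun b hb =>
      (Equiv.injective (r b)) (le_antisymm (ha ▸ hE b a) (hb.2 _ (hS b)))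
    rw [key i hi, key l hl]
  · rintro ⟨ψ, hψ, hS, hE⟩
    exact ⟨ψ, hψ, fun a => mem_of_mem_erase (hS a), hE⟩

lemma isTop_iff_isTop_erase {S : Finset (Fin m)} {r : Ranking m} {x y : Fin m} (hx : x ∈ S)
    (hxy : y ≠ x) : IsTop r S y ↔ IsTop r (S.erase x) y ∧ ¬ IsTop r S x := by
  constructor
  · intro h
    exact ⟨⟨mem_erase.2 ⟨hxy, h.1⟩, fun z hz => h.2 z (mem_of_mem_erase hz)⟩,
      fun h' => hxy (h.unique h')⟩
  · rintro ⟨h, h'⟩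
    obtain ⟨t, ht⟩ := exists_isTop r ⟨x, hx⟩
    have htx : t ≠ x := by rintro rfl; exact h' ht
    have : IsTop r (S.erase x) t :=
      ⟨mem_erase.2 ⟨htx, ht.1⟩, fun z hz => ht.2 z (mem_of_mem_erase hz)⟩
    rwa [h.unique this]

/-- The number of profiles admitting an envy-free assignment within `S`, and in which the
favourite in `S` of every agent `j` in `D` is `φ j`. -/
noncomputable def settledCount (n : ℕ) {m : ℕ} (S : Finset (Fin m)) (D : Finset (Fin n))
    (φ : Fin n → Fin m) : ℝ :=
  count (fun r : Fin n → Ranking m => EnvyFreeWithin S r ∧ ∀ j ∈ D, IsTop (r j) S (φ j))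

/-- The event splits into one about `S.erase (φ l)` and independent conditions on the contested
item: it is the favourite of `i` and of `l` (a factor `1 / |S|` each), and of none of the other `|D|
- 1` settled agents (a factor `(|S| - 1) / |S|` each). -/
lemma settledCount_conflict {S : Finset (Fin m)} {D : Finset (Fin n)} {φ : Fin n → Fin m}
    (hφ : Set.InjOn φ D) {i l : Fin n} (hi : i ∉ D) (hl : l ∈ D)
    (hlS : φ l ∈ S) :
    (S.card : ℝ) ^ (D.card + 1) * count (fun r : Fin n → Ranking m =>
        (EnvyFreeWithin S r ∧ ∀ j ∈ D, IsTop (r j) S (φ j)) ∧ IsTop (r i) S (φ l))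
      = (S.card - 1) ^ (D.card - 1) * settledCount n (S.erase (φ l)) (D.erase l) φ := by
  classical
  have hil : i ≠ l := by rintro rfl; exact hi hl
  set x := φ l with hx
  set P : (Fin n → Ranking m) → Prop := fun r => EnvyFreeWithin (S.erase x) r ∧
    ∀ j ∈ D.erase l, IsTop (r j) (S.erase x) (φ j) with hPdef
  have hP : ∀ a, DependsOnOrder (S.erase x) a P := fun a =>
    (dependsOnOrder_envyFreeWithin _ a).and (dependsOnOrder_isTop _ a _ _)
  have e1 : ∀ r : Fin n → Ranking m,
      ((EnvyFreeWithin S r ∧ ∀ j ∈ D, IsTop (r j) S (φ j)) ∧ IsTop (r i) S x) ↔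
      ((P r ∧ ∀ j ∈ D.erase l, ¬ IsTop (r j) S x) ∧ IsTop (r l) S x) ∧ IsTop (r i) S x := by
    intro r
    have h2 : (∀ j ∈ D, IsTop (r j) S (φ j)) ↔ IsTop (r l) S x ∧ ∀ j ∈ D.erase l,
        (IsTop (r j) (S.erase x) (φ j) ∧ ¬ IsTop (r j) S x) := by
      rw [← insert_erase hl, forall_mem_insert, erase_insert (notMem_erase l D)]
      refine and_congr_right fun _ => forall₂_congr fun j hj => isTop_iff_isTop_erase hlS ?_
      intro h
      exact (mem_erase.1 hj).1 (hφ (mem_of_mem_erase hj) hl h)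
    rw [h2]
    constructor
    · rintro ⟨⟨hE, hlx, hD⟩, hix⟩
      exact ⟨⟨⟨⟨(envyFreeWithin_erase_iff hil hix hlx).1 hE, fun j hj => (hD j hj).1⟩,
        fun j hj => (hD j hj).2⟩, hlx⟩, hix⟩
    · rintro ⟨⟨⟨⟨hE, hD⟩, hD'⟩, hlx⟩, hix⟩
      exact ⟨⟨(envyFreeWithin_erase_iff hil hix hlx).2 hE, hlx,
        fun j hj => ⟨hD j hj, hD' j hj⟩⟩, hix⟩
  have d1 : ∀ a, a ∉ D.erase l →
      DependsOnOrder (S.erase x) a (fun r => P r ∧ ∀ j ∈ D.erase l, ¬ IsTop (r j) S x) :=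
    fun a ha => (hP a).and (DependsOnOrder.of_notMem (B := fun _ b => ¬ IsTop b S x) ha)
  have d2 : DependsOnOrder (S.erase x) i
      (fun r => (P r ∧ ∀ j ∈ D.erase l, ¬ IsTop (r j) S x) ∧ IsTop (r l) S x) := by
    refine (d1 i fun h => hi (mem_of_mem_erase h)).and ?_
    intro r r' h _
    change IsTop (r l) S x ↔ IsTop (r' l) S x
    rw [h l hil.symm]
  have h3 := card_mul_count_isTop hlS i d2
  have h4 := card_mul_count_isTop hlS l (d1 l (notMem_erase l D))
  have h5 := card_pow_mul_count_not_isTop hlS hP (D.erase l)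
  rw [card_erase_of_mem hl] at h5
  have hD : D.card + 1 = (D.card - 1) + 1 + 1 := by
    have := card_pos.2 ⟨l, hl⟩; omega
  rw [count_congr e1, hD, pow_succ, mul_assoc, h3, pow_succ, mul_assoc, h4, h5]
  rfl

lemma count_eq_sum_isTop {S : Finset (Fin m)} (hS : S.Nonempty) (i : Fin n)
    (P : (Fin n → Ranking m) → Prop) :
    count P = ∑ x ∈ S, count (fun r => P r ∧ IsTop (r i) S x) := by
  classical
  unfold count
  rw [sum_comm]
  refine sum_congr rfl fun r _ => ?_
  obtain ⟨t, ht⟩ := exists_isTop (r i) hS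
  rw [sum_eq_single t]
  · simp [ht]
  · intro b _ hb
    exact if_neg fun h => hb (h.2.unique ht)
  · intro h; exact absurd ht.1 h

/-! ### The Markov chain and its hitting probability. -/

/-- The probability that the following chain with state `(f, k)` reaches `n ≤ k`: there are `f`
free items and `k` items tentatively taken by one agent each; a uniformly random item is drawn, a
free one becomes taken, and a taken one is discarded. -/
noncomputable def successProb (n : ℕ) : ℕ → ℕ → ℝ
  | 0, k => if n ≤ k then 1 else 0
  | f + 1, 0 => if f + 1 < n then 0 else if n = 0 then 1 else successProb n f 1
  | f + 1, k + 1 =>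
    if f + 1 + (k + 1) < n then 0 else if n ≤ k + 1 then 1 else
      ((f + 1 : ℝ) / (f + 1 + (k + 1)) * successProb n f (k + 2) +
        (k + 1 : ℝ) / (f + 1 + (k + 1)) * successProb n (f + 1) k)
-- Both moves, `(f - 1, k + 1)` and `(f, k - 1)`, lower this by exactly one.
termination_by f k => 2 * f + k

lemma successProb_of_lt {n f k : ℕ} (h : f + k < n) : successProb n f k = 0 := by
  cases f with
  | zero => rw [successProb, if_neg (by omega)]
  | succ f =>
    cases k with
    | zero => rw [successProb, if_pos (by omega)]
    | succ k => rw [successProb, if_pos (by omega)]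

lemma successProb_of_le {n f k : ℕ} (h : n ≤ k) : successProb n f k = 1 := by
  cases f with
  | zero => rw [successProb, if_pos h]
  | succ f =>
    cases k with
    | zero => rw [successProb, if_neg (by omega), if_pos (by omega)]
    | succ k => rw [successProb, if_neg (by omega), if_pos (by omega)]

/-- Cleared of denominators, the recursion covers `k = 0` too: the truncated `k - 1` then has
coefficient zero, while `f ≥ 1` follows from the hypotheses. -/
lemma successProb_step {n f k : ℕ} (h : n ≤ f + k) (h' : k < n) :
    (f + k : ℝ) * successProb n f k
      = f * successProb n (f - 1) (k + 1) + k * successProb n f (k - 1) := by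
  cases f with
  | zero => omega
  | succ f =>
    cases k with
    | zero =>
      rw [successProb, if_neg (by omega), if_neg (by omega)]
      simp
    | succ k =>
      rw [successProb, if_neg (by omega), if_neg (by omega)]
      have : (f + 1 + (k + 1) : ℝ) ≠ 0 := by positivity
      push_cast
      field_simp

/-- By `card_pow_mul_count_isTop`, the prescribed favourites hold in a fraction `|S| ^ (-|D|)` of
all profiles. So `successProb` is the conditional probability of `EnvyFreeWithin S` given them, and
it depends only on the two cardinalities. -/
theorem card_pow_mul_settledCount (S : Finset (Fin m)) (D : Finset (Fin n)) (φ : Fin n → Fin m)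
    (hφ : Set.InjOn φ D) (hS : ∀ i ∈ D, φ i ∈ S) :
    (S.card : ℝ) ^ D.card * settledCount n S D φ
      = count (fun _ : Fin n → Ranking m => True) *
        successProb n (S.card - D.card) D.card := by
  classical
  -- With `f = |S| - |D|` and `k = |D|` this is the measure `2 * f + k` of the chain.
  induction hN : 2 * S.card - D.card using Nat.strong_induction_on generalizing S D φ with
  | _ N ih =>
  subst hN
  have hDS : D.card ≤ S.card := card_le_card_of_injOn φ hS hφ
  have hDn : D.card ≤ n := by simpa using D.card_le_univ
  rcases lt_or_ge S.card n with hlt | hge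
  · rw [successProb_of_lt (by omega), settledCount, count_congr (P' := fun _ => False)]
    · simp [count]
    · intro r
      simp only [iff_false, not_and]
      intro h
      exact absurd h.le_card (by omega)
  rcases hDn.eq_or_lt with heq | hlt
  · have hD : D = univ := by rw [← card_eq_iff_eq_univ]; simpa using heq
    -- Once all agents are settled, `φ` itself is envy-free, so only the condition on favourites
    -- remains.
    rw [successProb_of_le heq.ge, mul_one, ← card_pow_mul_count_isTop D φ hS, settledCount]
    congr 1
    refine count_congr fun r => and_iff_right_of_imp fun h => ?_
    subst hD
    exact ⟨φ, fun a b hab => hφ (mem_univ a) (mem_univ b) hab, fun i => hS i (mem_univ i),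
      fun i j => (h i (mem_univ i)).2 _ (hS j (mem_univ j))⟩
  obtain ⟨i, hi⟩ : ∃ i, i ∉ D := by
    by_contra! h
    have : D = univ := eq_univ_of_forall h
    subst this
    simp at hlt
  have hSne : S.Nonempty := card_pos.1 (by omega)
  have himg : D.image φ ⊆ S := image_subset_iff.2 hS
  set K := count (fun _ : Fin n → Ranking m => True)
  have hs : (S.card : ℝ) ≠ 0 := by exact_mod_cast hSne.card_pos.ne'
  have hfree : ∀ x ∈ S \ D.image φ, (S.card : ℝ) ^ (D.card + 1) *
      count (fun r : Fin n → Ranking m =>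
        (EnvyFreeWithin S r ∧ ∀ j ∈ D, IsTop (r j) S (φ j)) ∧ IsTop (r i) S x)
      = K * successProb n (S.card - D.card - 1) (D.card + 1) := by
    intro x hx
    rw [Finset.mem_sdiff, mem_image] at hx
    push Not at hx
    have hupd : ∀ j ∈ D, update φ i x j = φ j := fun j hj =>
      update_of_ne (by rintro rfl; exact hi hj) _ _
    have h := ih (2 * S.card - (insert i D).card) (by rw [card_insert_of_notMem hi]; omega)
      S (insert i D) (update φ i x) (by
        rw [coe_insert, Set.injOn_insert (by simpa using hi)]
        refine ⟨hφ.congr fun j hj => (hupd j hj).symm, ?_⟩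
        rintro ⟨j, hj, hji⟩
        rw [hupd j hj, update_self] at hji
        exact hx.2 j hj hji) (by
        intro j hj
        rcases mem_insert.1 hj with rfl | hj
        · rw [update_self]; exact hx.1
        · rw [hupd j hj]; exact hS j hj) rfl
    rw [card_insert_of_notMem hi, ← Nat.sub_sub] at h
    rw [← h, settledCount]
    congr 1
    refine count_congr fun r => ?_
    rw [forall_mem_insert, update_self, and_assoc]
    refine and_congr_right fun _ => ?_
    rw [and_comm]
    refine and_congr_right fun _ => forall₂_congr fun j hj => ?_
    rw [hupd j hj]
  have hocc : ∀ l ∈ D, (S.card : ℝ) ^ (D.card + 1) *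
      count (fun r : Fin n → Ranking m =>
        (EnvyFreeWithin S r ∧ ∀ j ∈ D, IsTop (r j) S (φ j)) ∧ IsTop (r i) S (φ l))
      = K * successProb n (S.card - D.card) (D.card - 1) := by
    intro l hl
    have hDpos := card_pos.2 ⟨l, hl⟩
    have hc : (S.erase (φ l)).card = S.card - 1 := card_erase_of_mem (hS l hl)
    have hc' : (D.erase l).card = D.card - 1 := card_erase_of_mem hl
    have h := ih (2 * (S.erase (φ l)).card - (D.erase l).card) (by rw [hc, hc']; omega)
      (S.erase (φ l)) (D.erase l) φ (hφ.mono (by simp)) (by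
        intro j hj
        refine mem_erase.2 ⟨fun h => ?_, hS j (mem_of_mem_erase hj)⟩
        exact (mem_erase.1 hj).1 (hφ (mem_of_mem_erase hj) hl h)) rfl
    -- The power of `|S| - 1` produced here is exactly the normalisation in the induction hypothesis
    -- for the smaller state.
    rw [settledCount_conflict hφ hi hl (hS l hl)]
    rw [hc, hc', show S.card - 1 - (D.card - 1) = S.card - D.card by omega,
      Nat.cast_sub (by omega), Nat.cast_one] at h
    exact h
  have hsum : (S.card : ℝ) ^ (D.card + 1) * settledCount n S D φ =
      K * (((S.card - D.card : ℕ) : ℝ) * successProb n (S.card - D.card - 1) (D.card + 1)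
        + D.card * successProb n (S.card - D.card) (D.card - 1)) := by
    rw [settledCount, count_eq_sum_isTop hSne i, ← sum_sdiff himg, mul_add, mul_sum, mul_sum,
      sum_congr rfl hfree, sum_image (fun a ha b hb h => hφ ha hb h), sum_congr rfl hocc,
      sum_const, sum_const, card_sdiff_of_subset himg, card_image_of_injOn hφ,
      nsmul_eq_mul, nsmul_eq_mul]
    ring
  rw [← successProb_step (by omega) hlt, ← Nat.cast_add, Nat.sub_add_cancel hDS, pow_succ] at hsum
  refine mul_left_cancel₀ hs ?_
  linear_combination hsum

lemma profileLaw_singleton (r : Fin n → Ranking m) :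
    profileLaw n m {r} = (Fintype.card (Fin n → Ranking m) : ENNReal)⁻¹ := by
  classical
  rw [profileLaw, Measure.pi_singleton]
  simp [ENNReal.inv_pow]

instance (n m : ℕ) : IsProbabilityMeasure (profileLaw n m) := by
  unfold profileLaw; infer_instance

lemma profileLaw_setOf (P : (Fin n → Ranking m) → Prop) :
    profileLaw n m {r | P r}
      = ENNReal.ofReal (count P / count (fun _ : Fin n → Ranking m => True)) := by
  classical
  have h : ({r | P r} : Set (Fin n → Ranking m)) = ((univ.filter P : Finset _) : Set _) := by simp
  have hpos : 0 < (Fintype.card (Fin n → Ranking m) : ℝ) := by exact_mod_cast Fintype.card_pos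
  rw [h, ← sum_measure_singleton, sum_congr rfl fun r _ => profileLaw_singleton r]
  have h1 : count (fun _ : Fin n → Ranking m => True)
    = Fintype.card (Fin n → Ranking m) := by simp [count]
  have h2 : count P = (univ.filter P).card := by simp [count]
  rw [h1, h2, ENNReal.ofReal_div_of_pos hpos, ENNReal.ofReal_natCast, ENNReal.ofReal_natCast,
    sum_const, nsmul_eq_mul, div_eq_mul_inv]

/-- The probability that an envy-free assignment exists, as a hitting probability. -/
theorem profileLaw_envyFreeAssignmentExists (n m : ℕ) :
    profileLaw n m (envyFreeAssignmentExists n m) = ENNReal.ofReal (successProb n m 0) := by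
  classical
  have hE : envyFreeAssignmentExists n m
      = {r | EnvyFreeWithin (univ : Finset (Fin m)) r} := by
    simp [envyFreeAssignmentExists, EnvyFreeWithin]
  rw [hE]
  rcases isEmpty_or_nonempty (Fin n → Fin m) with hem | ⟨⟨φ⟩⟩
  · have hmn : m < n := by
      by_contra! h
      exact hem.elim (Fin.castLE h)
    rw [successProb_of_lt (by omega), ENNReal.ofReal_zero]
    convert measure_empty (μ := profileLaw n m)
    exact Set.eq_empty_of_forall_notMem fun r ⟨ψ, _⟩ => hem.elim ψ
  · have h := card_pow_mul_settledCount (n := n) (univ : Finset (Fin m)) ∅ φ (by simp) (by simp)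
    simp only [card_empty, pow_zero, one_mul, card_univ, Fintype.card_fin, Nat.sub_zero,
      settledCount, notMem_empty, IsEmpty.forall_iff, implies_true, and_true] at h
    have h1 : count (fun _ : Fin n → Ranking m => True) ≠ 0 := by simp [count]
    rw [profileLaw_setOf]
    congr 1
    rw [h, mul_div_cancel_left₀ _ h1]

end Profiles


/-! ### The martingale and its quadratic correction. -/

section Potential

/-- A martingale of the chain of `successProb`. -/
noncomputable def potential (f k : ℕ) : ℝ := k / (f + 1) + (harmonic f : ℝ)

lemma potential_zero_right (f : ℕ) : potential f 0 = (harmonic f : ℝ) := by simp [potential]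

/-- This gain, weighted by `f`, cancels the loss in `potential_pred_right`, weighted by `k`: this is
the martingale property. -/
lemma potential_pred_succ {f : ℕ} (hf : 1 ≤ f) (k : ℕ) :
    potential (f - 1) (k + 1) = potential f k + k / (f * (f + 1)) := by
  obtain ⟨f, rfl⟩ := Nat.exists_eq_add_of_le' hf
  have h : (f + 1 : ℝ) ≠ 0 := by positivity
  have h' : (f + 1 + 1 : ℝ) ≠ 0 := by positivity
  rw [Nat.add_sub_cancel, potential, potential, harmonic_succ]
  push_cast
  field_simp
  ring

lemma potential_pred_right (f : ℕ) {k : ℕ} (hk : 1 ≤ k) :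
    potential f (k - 1) = potential f k - 1 / (f + 1) := by
  obtain ⟨k, rfl⟩ := Nat.exists_eq_add_of_le' hk
  rw [Nat.add_sub_cancel, potential, potential]
  push_cast
  ring

/-- The squared deviation of the martingale from `c`, corrected by a bound on the quadratic
variation still to come. -/
noncomputable def quadPotential (c A B : ℝ) (f k : ℕ) : ℝ :=
  (potential f k - c) ^ 2 + A * (B - 1 / f)

lemma quadPotential_step (c B : ℝ) {A K : ℝ} (hA : K * (1 + K) ≤ A) {f k : ℕ} (hf : 2 ≤ f)
    (hk : (k : ℝ) ≤ K * f) :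
    f * quadPotential c A B (f - 1) (k + 1) + k * quadPotential c A B f (k - 1)
      ≤ (f + k) * quadPotential c A B f k := by
  have hf2 : (2 : ℝ) ≤ f := by exact_mod_cast hf
  have hk0 : (0 : ℝ) ≤ k := Nat.cast_nonneg k
  have hfne : (f : ℝ) ≠ 0 := by positivity
  have hf1 : (f : ℝ) - 1 ≠ 0 := by linarith
  have hfp : (f : ℝ) + 1 ≠ 0 := by positivity
  set a := potential f k - c with ha
  have h1 : quadPotential c A B (f - 1) (k + 1)
      = (a + k / (f * (f + 1))) ^ 2 + A * (B - 1 / (f - 1)) := by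
    rw [quadPotential, potential_pred_succ (by omega), Nat.cast_sub (by omega), Nat.cast_one]
    ring
  have h2 : (k : ℝ) * quadPotential c A B f (k - 1)
      = k * ((a - 1 / (f + 1)) ^ 2 + A * (B - 1 / f)) := by
    rcases Nat.eq_zero_or_pos k with rfl | hkpos
    · simp
    · rw [quadPotential, potential_pred_right f hkpos]
      ring
  rw [h1, h2, quadPotential, ← ha]
  -- The terms linear in `a` cancel. What remains is the drop in the correction term minus the
  -- variance of the step, both multiplied by `f + k`.
  have h3 : (f + k) * (a ^ 2 + A * (B - 1 / f)) -
      (f * ((a + k / (f * (f + 1))) ^ 2 + A * (B - 1 / (f - 1))) +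
        k * ((a - 1 / (f + 1)) ^ 2 + A * (B - 1 / f)))
      = A / (f - 1) - k * (f + k) / (f * (f + 1) ^ 2) := by
    field_simp
    ring
  have hK : 0 ≤ K := by
    by_contra! h
    nlinarith
  have h4 : k * (f + k) / (f * (f + 1) ^ 2) ≤ A / ((f : ℝ) - 1) := by
    rw [div_le_div_iff₀ (by positivity) (by linarith)]
    have h5 : (k : ℝ) * (f + k) ≤ A * f ^ 2 := by
      calc (k : ℝ) * (f + k) ≤ (K * f) * (f + K * f) := by gcongr
        _ = K * (1 + K) * f ^ 2 := by ring
        _ ≤ A * f ^ 2 := by gcongr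
    have hA0 : 0 ≤ A := le_trans (by positivity) hA
    calc (k : ℝ) * (f + k) * (f - 1) ≤ A * f ^ 2 * (f - 1) := by gcongr; linarith
      _ ≤ A * (f * (f + 1) ^ 2) := by
        have : 0 ≤ A * (f * (3 * f + 1)) := by positivity
        nlinarith
  linarith

lemma quadPotential_nonneg {c A B : ℝ} (hA : 0 ≤ A) {f : ℕ} (hB : 1 / (f : ℝ) ≤ B) (k : ℕ) :
    0 ≤ quadPotential c A B f k := by
  unfold quadPotential
  have := mul_nonneg hA (sub_nonneg.2 hB)
  positivity

lemma sq_le_quadPotential {c A B δ : ℝ} (hA : 0 ≤ A) {f k : ℕ} (hB : 1 / (f : ℝ) ≤ B)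
    (hδ : 0 ≤ δ) (h : δ ≤ |potential f k - c|) :
    δ ^ 2 ≤ quadPotential c A B f k := by
  unfold quadPotential
  have := mul_nonneg hA (sub_nonneg.2 hB)
  have h2 : δ ^ 2 ≤ (potential f k - c) ^ 2 := by
    rw [← sq_abs (potential f k - c)]
    gcongr
  linarith

lemma successProb_nonneg_le_one (n f k : ℕ) :
    0 ≤ successProb n f k ∧ successProb n f k ≤ 1 := by
  induction hN : 2 * f + k using Nat.strong_induction_on generalizing f k with
  | _ N ih =>
  subst hN
  rcases lt_or_ge (f + k) n with h | h
  · rw [successProb_of_lt h]; norm_num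
  rcases le_or_gt n k with h' | h'
  · rw [successProb_of_le h']; norm_num
  have hs := successProb_step h h'
  have h1 := ih (2 * (f - 1) + (k + 1)) (by omega) _ _ rfl
  have h2 : 0 ≤ (k : ℝ) * successProb n f (k - 1) ∧ k * successProb n f (k - 1) ≤ k := by
    rcases Nat.eq_zero_or_pos k with rfl | hk
    · simp
    · have := ih (2 * f + (k - 1)) (by omega) _ _ rfl
      exact ⟨mul_nonneg (Nat.cast_nonneg _) this.1,
        mul_le_of_le_one_right (Nat.cast_nonneg _) this.2⟩
  have h3 : 0 ≤ (f : ℝ) * successProb n (f - 1) (k + 1) ∧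
      f * successProb n (f - 1) (k + 1) ≤ f :=
    ⟨mul_nonneg (Nat.cast_nonneg _) h1.1, mul_le_of_le_one_right (Nat.cast_nonneg _) h1.2⟩
  have hpos : (0 : ℝ) < f + k := by
    have : 0 < f + k := by omega
    exact_mod_cast this
  exact ⟨nonneg_of_mul_nonneg_right (by rw [hs]; linarith) hpos,
    le_of_mul_le_mul_left (by rw [hs]; linarith) hpos⟩

end Potential

/-! ### Concentration of the chain on either side of the threshold. -/

section Bounds

lemma log_le_harmonic_sub {f m : ℕ} (h : f ≤ m) :
    Real.log ((m + 1) / (f + 1)) ≤ (harmonic m : ℝ) - harmonic f := by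
  have := Real.strictMono_eulerMascheroniSeq.monotone h
  unfold Real.eulerMascheroniSeq at this
  rw [Real.log_div (by positivity) (by positivity)]
  linarith

lemma harmonic_sub_le_log {f m : ℕ} (hf : 0 < f) (h : f ≤ m) :
    (harmonic m : ℝ) - harmonic f ≤ Real.log (m / f) := by
  have := Real.strictAnti_eulerMascheroniSeq'.antitone h
  unfold Real.eulerMascheroniSeq' at this
  rw [if_neg (by omega), if_neg (by omega)] at this
  rw [Real.log_div (by norm_cast; omega) (by norm_cast; omega)]
  linarith

/-- If the martingale has to move by `δ` before the chain can fail, failure is unlikely. -/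
lemma one_sub_successProb_le {n : ℕ} (hn : 2 ≤ n) {δ c : ℝ} (hδ : 0 < δ)
    (hc : 1 + harmonic n + δ ≤ c) {f : ℕ} (hf : n ≤ f) (k : ℕ) :
    δ ^ 2 * (1 - successProb n f k) ≤ quadPotential c 2 (1 / n) f k := by
  induction hN : 2 * f + k using Nat.strong_induction_on generalizing f k with
  | _ N ih =>
  subst hN
  have hn0 : (0 : ℝ) < n := by positivity
  have hnf : (n : ℝ) ≤ f := by exact_mod_cast hf
  have hB : 1 / (f : ℝ) ≤ 1 / n := by gcongr
  rcases le_or_gt n k with h' | h'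
  · rw [successProb_of_le h', sub_self, mul_zero]
    exact quadPotential_nonneg (by norm_num) hB k
  -- At `f = n` with `k < n` the potential is below `1 + H_n`, so it has already moved by `δ`. The
  -- recursion stops here, and failure counts as certain.
  rcases hf.eq_or_lt with rfl | hlt
  · have h1 := (successProb_nonneg_le_one n n k).1
    have h2 : δ ^ 2 ≤ quadPotential c 2 (1 / n) n k := by
      refine sq_le_quadPotential (by norm_num) hB hδ.le ?_
      have : (k : ℝ) / (n + 1) ≤ 1 := by
        rw [div_le_one (by positivity)]
        have : (k : ℝ) < n := by exact_mod_cast h'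
        linarith
      rw [abs_sub_comm]
      refine le_trans ?_ (le_abs_self _)
      rw [potential]
      linarith
    nlinarith [sq_nonneg δ]
  · have hs := successProb_step (n := n) (f := f) (k := k) (by omega) h'
    have h1 := ih (2 * (f - 1) + (k + 1)) (by omega) (f := f - 1) (by omega) _ rfl
    have h2 : (k : ℝ) * (δ ^ 2 * (1 - successProb n f (k - 1)))
        ≤ k * quadPotential c 2 (1 / n) f (k - 1) := by
      rcases Nat.eq_zero_or_pos k with rfl | hk
      · simp
      · exact mul_le_mul_of_nonneg_left (ih (2 * f + (k - 1)) (by omega) hf _ rfl)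
          (Nat.cast_nonneg _)
    have h3 : (f : ℝ) * (δ ^ 2 * (1 - successProb n (f - 1) (k + 1)))
        ≤ f * quadPotential c 2 (1 / n) (f - 1) (k + 1) :=
      mul_le_mul_of_nonneg_left h1 (Nat.cast_nonneg _)
    have hkn : (k : ℝ) ≤ n := by exact_mod_cast h'.le
    have h4 := quadPotential_step c (1 / n) (A := 2) (K := 1) (by norm_num) (f := f) (k := k)
      (by omega) (by linarith)
    have hpos : (0 : ℝ) < f + k := by linarith [Nat.cast_nonneg (α := ℝ) k]
    refine le_of_mul_le_mul_left ?_ hpos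
    calc (f + k) * (δ ^ 2 * (1 - successProb n f k))
        = f * (δ ^ 2 * (1 - successProb n (f - 1) (k + 1)))
          + k * (δ ^ 2 * (1 - successProb n f (k - 1))) := by
            linear_combination -δ ^ 2 * hs
      _ ≤ _ := by linarith

/-- If the martingale has to move by `δ` before the chain can succeed, success is unlikely. -/
lemma successProb_le {n m f₀ : ℕ} (hf₀ : 1 ≤ f₀) (hn : n ≤ 20 * f₀) {δ c : ℝ} (hδ : 0 < δ)
    (hsucc : ∀ f k : ℕ, f₀ ≤ f → f ≤ m → n ≤ k → c + δ ≤ potential f k)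
    (hlow : ∀ k : ℕ, n ≤ f₀ + k → c + δ ≤ potential f₀ k)
    {f : ℕ} (hf : f₀ ≤ f) (hfm : f ≤ m) (k : ℕ) :
    δ ^ 2 * successProb n f k ≤ quadPotential c 420 (1 / f₀) f k := by
  induction hN : 2 * f + k using Nat.strong_induction_on generalizing f k with
  | _ N ih =>
  subst hN
  have hf0 : (0 : ℝ) < f₀ := by exact_mod_cast hf₀
  have hff : (f₀ : ℝ) ≤ f := by exact_mod_cast hf
  have hB : 1 / (f : ℝ) ≤ 1 / f₀ := by gcongr
  have hle := (successProb_nonneg_le_one n f k).2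
  have hbig : c + δ ≤ potential f k → δ ^ 2 * successProb n f k ≤
      quadPotential c 420 (1 / f₀) f k := by
    intro h
    refine (mul_le_of_le_one_right (sq_nonneg δ) hle).trans
      (sq_le_quadPotential (by norm_num) hB hδ.le ?_)
    exact le_trans (by linarith) (le_abs_self _)
  rcases le_or_gt n k with h' | h'
  · exact hbig (hsucc f k hf hfm h')
  rcases lt_or_ge (f + k) n with h | h
  · rw [successProb_of_lt h, mul_zero]
    exact quadPotential_nonneg (by norm_num) hB k
  rcases hf.eq_or_lt with rfl | hlt
  · exact hbig (hlow k h)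
  · have hs := successProb_step h h'
    have h1 := ih (2 * (f - 1) + (k + 1)) (by omega) (f := f - 1) (by omega) (by omega) _ rfl
    have h2 : (k : ℝ) * (δ ^ 2 * successProb n f (k - 1))
        ≤ k * quadPotential c 420 (1 / f₀) f (k - 1) := by
      rcases Nat.eq_zero_or_pos k with rfl | hk
      · simp
      · exact mul_le_mul_of_nonneg_left (ih (2 * f + (k - 1)) (by omega) hf hfm _ rfl)
          (Nat.cast_nonneg _)
    have h3 : (f : ℝ) * (δ ^ 2 * successProb n (f - 1) (k + 1))
        ≤ f * quadPotential c 420 (1 / f₀) (f - 1) (k + 1) :=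
      mul_le_mul_of_nonneg_left h1 (Nat.cast_nonneg _)
    -- From `k < n ≤ 20 * f₀`; hence `K = 20` and `A = 20 * 21 = 420`.
    have hkn : k ≤ 20 * f := by omega
    have h4 := quadPotential_step c (1 / f₀) (A := 420) (K := 20) (by norm_num) (f := f) (k := k)
      (by omega) (by exact_mod_cast hkn)
    have hpos : (0 : ℝ) < f + k := by linarith [Nat.cast_nonneg (α := ℝ) k]
    refine le_of_mul_le_mul_left ?_ hpos
    calc (f + k) * (δ ^ 2 * successProb n f k)
        = f * (δ ^ 2 * successProb n (f - 1) (k + 1))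
          + k * (δ ^ 2 * successProb n f (k - 1)) := by
            linear_combination δ ^ 2 * hs
      _ ≤ _ := by linarith

lemma one_sub_successProb_zero_le {n m : ℕ} (hn : 2 ≤ n) {δ : ℝ} (hδ : 0 < δ)
    (hm : Real.exp (1 + δ) * (n + 1) ≤ m + 1) :
    1 - successProb n m 0 ≤ 2 / (n * δ ^ 2) := by
  have hnm : n ≤ m := by
    have h1 : (1 : ℝ) ≤ Real.exp (1 + δ) := Real.one_le_exp (by positivity)
    have h2 : (n : ℝ) + 1 ≤ m + 1 := le_trans (le_mul_of_one_le_left (by positivity) h1) hm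
    exact_mod_cast (add_le_add_iff_right 1).1 h2
  have hlog : 1 + δ ≤ Real.log ((m + 1) / (n + 1)) := by
    rw [Real.le_log_iff_exp_le (by positivity), le_div_iff₀ (by positivity)]
    exact hm
  have h := one_sub_successProb_le hn hδ (c := harmonic m)
    (by linarith [log_le_harmonic_sub hnm]) hnm 0
  rw [quadPotential, potential_zero_right, sub_self] at h
  have hn0 : (0 : ℝ) < n := by positivity
  have hm0 : (0 : ℝ) ≤ 1 / m := by positivity
  rw [le_div_iff₀ (by positivity)]
  have h2 : n * (δ ^ 2 * (1 - successProb n m 0)) ≤ n * (2 * (1 / n)) := by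
    exact mul_le_mul_of_nonneg_left (by linarith) hn0.le
  have h3 : n * (2 * (1 / n)) = (2 : ℝ) := by field_simp
  linarith

lemma successProb_zero_le {n m : ℕ} {δ : ℝ} (hδ : 0 < δ) (hn : 1000 ≤ n)
    (hnδ : 121 ≤ n * δ) (hm : (m : ℝ) ≤ Real.exp (1 - 2 * δ) * n) :
    successProb n m 0 ≤ 4620 / (n * δ ^ 2) := by
  have hn0 : (0 : ℝ) < n := by positivity
  rcases lt_or_ge m n with hmn | hnm
  · rw [successProb_of_lt (by omega)]
    positivity
  -- The chain is stopped at `f₀`, keeping the variation bound of order `1 / n`. The final constant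
  -- is `11 * 420 = 4620`.
  set f₀ := n / 10 with hf₀
  have hn1 : n ≤ 11 * f₀ := by omega
  have hf₀pos : 0 < f₀ := by omega
  have hlogm : Real.log (m / n) ≤ 1 - 2 * δ := by
    have hm0 : (0 : ℝ) < m := lt_of_lt_of_le hn0 (by exact_mod_cast hnm)
    rw [Real.log_le_iff_le_exp (by positivity), div_le_iff₀ hn0]
    exact hm
  have hharm : ∀ f : ℕ, f₀ ≤ f → f ≤ m →
      (harmonic m : ℝ) - harmonic f ≤ 1 - 2 * δ + Real.log (n / f) := by
    intro f hf hfm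
    have hfp : (f : ℝ) ≠ 0 := by norm_cast; omega
    have hmp : (m : ℝ) ≠ 0 := by norm_cast; omega
    have h1 := harmonic_sub_le_log (by omega) hfm
    rw [Real.log_div hmp hfp] at h1
    rw [Real.log_div hmp hn0.ne'] at hlogm
    rw [Real.log_div hn0.ne' hfp]
    linarith
  have key := successProb_le (n := n) (m := m) (f₀ := f₀) (by omega) (by omega) hδ
    (c := harmonic m) ?_ ?_ (f := m) (by omega) le_rfl 0
  · rw [quadPotential, potential_zero_right, sub_self] at key
    have hf : (0 : ℝ) < f₀ := by exact_mod_cast hf₀pos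
    have hm0 : (0 : ℝ) ≤ 1 / m := by positivity
    have hnf : (n : ℝ) ≤ 11 * f₀ := by exact_mod_cast hn1
    rw [le_div_iff₀ (by positivity)]
    have h2 : n * (δ ^ 2 * successProb n m 0) ≤ (11 * f₀) * (420 * (1 / f₀)) := by
      have := (successProb_nonneg_le_one n m 0).1
      exact mul_le_mul hnf (by linarith) (by positivity) (by positivity)
    have h3 : (11 * f₀) * (420 * (1 / f₀)) = (4620 : ℝ) := by field_simp; norm_num
    linarith
  · intro f k hf hfm hk
    have hfp : (0 : ℝ) < f := by
      have : 0 < f := by omega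
      exact_mod_cast this
    have h1 := hharm f hf hfm
    -- The inequality `log x ≤ x - 1` at `x = n / f` is what makes `e` the threshold: `H_m - H_f ≤ n
    -- / f - 2 * δ`. Replacing `f` by `f + 1` in `n / f` costs at most one `δ`, because `121 ≤ n *
    -- δ`.
    have h2 := Real.log_le_sub_one_of_pos (x := n / f) (by positivity)
    have hkn : (n : ℝ) ≤ k := by exact_mod_cast hk
    have h3 : (n : ℝ) / (f + 1) ≤ k / (f + 1) := by gcongr
    have hnf : (n : ℝ) ≤ 11 * f := by
      have : n ≤ 11 * f := by omega
      exact_mod_cast this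
    have h4 : (n : ℝ) / f - δ ≤ n / (f + 1) := by
      rw [sub_le_iff_le_add, div_add' _ _ _ (by positivity), div_le_div_iff₀ hfp (by positivity)]
      have h5 : (n : ℝ) ≤ δ * f ^ 2 := by
        have h6 : (n : ℝ) ^ 2 ≤ 121 * f ^ 2 := by nlinarith
        have h7 : (n : ℝ) * n ≤ n * (δ * f ^ 2) := by
          calc (n : ℝ) * n = n ^ 2 := by ring
            _ ≤ 121 * f ^ 2 := h6
            _ ≤ (n * δ) * f ^ 2 := by gcongr
            _ = _ := by ring
        exact le_of_mul_le_mul_left h7 hn0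
      nlinarith [mul_pos hδ hfp]
    rw [potential]
    linarith
  · intro k hk
    have hfp : (0 : ℝ) < f₀ := by exact_mod_cast hf₀pos
    have h1 := hharm f₀ le_rfl (by omega)
    -- A chain still alive at `f₀` has `k ≥ 9 * f₀`, so `k / (f₀ + 1) ≥ 8`. This far exceeds `H_m -
    -- H_{f₀} ≤ 4 - 2 * δ`.
    have hk8 : 8 * (f₀ + 1) ≤ k := by omega
    have h8 : (8 : ℝ) ≤ k / (f₀ + 1) := by
      rw [le_div_iff₀ (by positivity)]
      exact_mod_cast hk8
    have hnf : (n : ℝ) ≤ 11 * f₀ := by exact_mod_cast hn1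
    have h2 : Real.log (n / f₀) ≤ 3 := by
      rw [Real.log_le_iff_le_exp (by positivity), div_le_iff₀ hfp]
      have : (11 : ℝ) ≤ Real.exp 3 := by
        rw [show (3 : ℝ) = 1 + 1 + 1 by norm_num, Real.exp_add, Real.exp_add]
        have := Real.exp_one_gt_d9
        nlinarith
      nlinarith
    rw [potential]
    linarith

end Bounds

end HouseAllocation

/-! ### The sharp threshold at `e`. -/

theorem theorem6p1 (ε : ℝ) (hε : 0 < ε) (m : ℕ → ℕ) :
    ((∀ᶠ n : ℕ in atTop, Real.exp 1 + ε ≤ (m n : ℝ) / (n : ℝ)) →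
      Tendsto (fun n : ℕ => HouseAllocation.profileLaw n (m n)
        (HouseAllocation.envyFreeAssignmentExists n (m n))) atTop (𝓝 1)) ∧
    ((∀ᶠ n : ℕ in atTop, (m n : ℝ) / (n : ℝ) ≤ Real.exp 1 - ε) →
      Tendsto (fun n : ℕ => HouseAllocation.profileLaw n (m n)
        (HouseAllocation.envyFreeAssignmentExists n (m n))ᶜ) atTop (𝓝 1)) := by
  have hlim : ∀ C δ : ℝ, Tendsto (fun n : ℕ => C / (n * δ ^ 2)) atTop (𝓝 0) := fun C δ => by
    have := (tendsto_const_div_atTop_nhds_zero_nat C).div_const (δ ^ 2)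
    simpa only [div_div, zero_div] using this
  simp only [prob_compl_eq_one_sub (Set.toFinite _).measurableSet,
    HouseAllocation.profileLaw_envyFreeAssignmentExists]
  constructor
  · intro hm
    -- Half of `ε` goes into `δ`; the other half gives the slack `n * (ε / 2)` that absorbs the
    -- shift from `n` to `n + 1`.
    set δ := Real.log (Real.exp 1 + ε / 2) - 1
    have hexp : Real.exp (1 + δ) = Real.exp 1 + ε / 2 := by
      rw [add_sub_cancel, Real.exp_log (by positivity)]
    have hδ : 0 < δ := by
      rw [sub_pos, Real.lt_log_iff_exp_lt (by positivity)]
      linarith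
    have h1 : Tendsto (fun n : ℕ => HouseAllocation.successProb n (m n) 0) atTop (𝓝 1) := by
      refine tendsto_of_tendsto_of_tendsto_of_le_of_le' (g := fun n : ℕ => 1 - 2 / (n * δ ^ 2))
        (h := fun _ => 1) (by simpa using (hlim 2 δ).const_sub 1) tendsto_const_nhds ?_
        (Eventually.of_forall fun n => (HouseAllocation.successProb_nonneg_le_one n (m n) 0).2)
      have hlarge : ∀ᶠ n : ℕ in atTop, Real.exp 1 + ε / 2 ≤ n * (ε / 2) :=
        (tendsto_natCast_atTop_atTop.atTop_mul_const (by positivity)).eventually_ge_atTop _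
      filter_upwards [hm, hlarge, eventually_ge_atTop 2] with n hmn hn hn2
      have hn0 : (0 : ℝ) < n := by positivity
      rw [le_div_iff₀ hn0] at hmn
      rw [sub_le_comm]
      refine HouseAllocation.one_sub_successProb_zero_le hn2 hδ ?_
      rw [hexp]
      linarith
    simpa using ENNReal.tendsto_ofReal h1
  · intro hm
    -- The maximum with `1` keeps the logarithm meaningful when `e - ε` is not positive.
    set c := max (Real.exp 1 - ε) 1
    have hc0 : 0 < c := lt_max_of_lt_right one_pos
    have hce : c < Real.exp 1 := max_lt (by linarith) (by linarith [Real.add_one_lt_exp one_ne_zero])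
    set δ := (1 - Real.log c) / 2
    have hexp : Real.exp (1 - 2 * δ) = c := by
      rw [mul_div_cancel₀ _ two_ne_zero, sub_sub_cancel, Real.exp_log hc0]
    have hδ : 0 < δ := by
      have : Real.log c < 1 := (Real.log_lt_iff_lt_exp hc0).2 hce
      exact div_pos (by linarith) two_pos
    have h1 : Tendsto (fun n : ℕ => HouseAllocation.successProb n (m n) 0) atTop (𝓝 0) := by
      refine tendsto_of_tendsto_of_tendsto_of_le_of_le' (g := fun _ => 0) tendsto_const_nhds
        (hlim 4620 δ)
        (Eventually.of_forall fun n => (HouseAllocation.successProb_nonneg_le_one n (m n) 0).1) ?_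
      have hlarge : ∀ᶠ n : ℕ in atTop, 121 ≤ n * δ :=
        (tendsto_natCast_atTop_atTop.atTop_mul_const hδ).eventually_ge_atTop _
      filter_upwards [hm, hlarge, eventually_ge_atTop 1000] with n hmn hn hn2
      have hn0 : (0 : ℝ) < n := by positivity
      refine HouseAllocation.successProb_zero_le hδ hn2 hn ?_
      rw [hexp, ← div_le_iff₀ hn0]
      exact hmn.trans (le_max_left _ _)
    simpa using ENNReal.Tendsto.sub tendsto_const_nhds (ENNReal.tendsto_ofReal h1)
      (Or.inl ENNReal.one_ne_top)
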